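/- Let $\xi_1,\eta_1,\xi_2,\eta_2$ be independent random variables, each exponentially distributed with parameter $1$. For $r_1,r_2\in[0,1]$ put $$X(r_1,r_2)=\xi_1\,(\ln(1+\eta_1))^{r_1}\cdot\xi_2\,(\ln(1+\eta_2))^{r_2}.$$ All moments $m_n=\mathbf E[X(r_1,r_2)^n]$ are finite, and $$m_n=(n!)^2K_n(r_1)K_n(r_2),\qquad K_n(r)=\int_0^\infty[\ln(1+x)]^{nr}e^{-x}\,dx .$$ For every choice of $r_1,r_2\in[0,1]$ the moments satisfy Carleman's condition $\sum_{n=1}^\infty m_n^{-1/(2n)}=\infty$, and $X(r_1,r_2)$ is M-determinate: its distribution is the only probability distribution on $[0,\infty)$ with the moments $m_n$, $n=1,2,\ldots$. If moreover $(r_1,r_2)\neq(0,0)$, then the moments do not satisfy the quadratic growth condition $m_{n+1}/m_n=\mathcal O((n+1)^2)$ as $n\to\infty$. -/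

import Mathlib

open MeasureTheory ProbabilityTheory Filter Asymptotics

/-- The random variable `X(r₁, r₂) = ξ₁ (ln (1 + η₁))^r₁ · ξ₂ (ln (1 + η₂))^r₂`. -/
noncomputable def productVar {Ω : Type*} (ξ₁ η₁ ξ₂ η₂ : Ω → ℝ) (r₁ r₂ : ℝ) : Ω → ℝ := fun ω =>
  (ξ₁ ω * Real.log (1 + η₁ ω) ^ r₁) * (ξ₂ ω * Real.log (1 + η₂ ω) ^ r₂)

/-- `K_n(r) = ∫_0^∞ (ln (1 + x))^(n r) e^(-x) dx`. -/
noncomputable def logMoment (n : ℕ) (r : ℝ) : ℝ :=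
  ∫ x in Set.Ioi (0 : ℝ), Real.log (1 + x) ^ ((n : ℝ) * r) * Real.exp (-x)

/-- Carleman's condition in the Stieltjes case, `∑_{n ≥ 1} m_n^(-1/(2n)) = ∞`,
for a sequence of positive numbers: the partial sums tend to infinity. -/
def CarlemanCondition (m : ℕ → ℝ) : Prop :=
  Tendsto (fun N : ℕ => ∑ n ∈ Finset.Icc 1 N, m n ^ (-(1 / (2 * (n : ℝ))))) atTop atTop

/-- Quadratic rate of growth, `m_{n+1} / m_n = O((n+1)^2)` as `n → ∞`. -/
def QuadraticGrowth (m : ℕ → ℝ) : Prop :=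
  (fun n : ℕ => m (n + 1) / m n) =O[atTop] (fun n : ℕ => ((n : ℝ) + 1) ^ 2)

/-- `μ` is a probability distribution on `[0, ∞)` all of whose moments are finite. -/
structure IsStieltjesLaw (μ : Measure ℝ) : Prop where
  isProbabilityMeasure : IsProbabilityMeasure μ
  nonneg : μ (Set.Iio 0) = 0
  integrable_pow : ∀ n : ℕ, Integrable (fun x : ℝ => x ^ n) μ

/-- The law `μ` is M-determinate (Stieltjes moment problem): it is a distribution on `[0, ∞)` with
finite moments, and the only such distribution with its moments. -/
def IsMDeterminate (μ : Measure ℝ) : Prop :=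
  IsStieltjesLaw μ ∧
    ∀ ν : Measure ℝ, IsStieltjesLaw ν →
      (∀ n : ℕ, 1 ≤ n → ∫ x, x ^ n ∂ν = ∫ x, x ^ n ∂μ) → ν = μ

/-! The logarithms grow so slowly that K_n(r) ≤ 2(2 + ln(1+n))^n. With n! ≤ n^n this gives
m_n^(-1/(2n)) ≥ 1/(2n(2 + ln(1+n))), whose partial sums diverge like ln ln N: Carleman's condition.
If some r_i > 0, restricting the integrals to x > T with T large shows that K_n(r_1)K_n(r_2)
outgrows every geometric sequence, whereas quadratic growth of m_n would bound it by one.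

Carleman's criterion itself rests on quasi-analyticity. If two laws share their moments, the
transforms t ↦ ∫ cos(t√x) have equal derivatives of every order at 0, and their n-th derivatives are
at most √m_n. Cauchy–Schwarz makes √m_n log-convex, and `carleman_inequality` turns ∑ m_n^(-1/(2n))
= ∞ into ∑ √m_n/√m_(n+1) = ∞. Then `denjoy_carleman` makes the transforms agree on [0, ∞), and
`ext_of_cosMoment` identifies the laws. -/

/-! ### Quasi-analyticity: the Denjoy–Carleman theorem -/

/-- One step of Bang's argument: if all derivatives of `F 0` are at most `exp (j - (N + 1)) * M j`
at `x`, they are at most `exp (j - N) * M j` up to distance `M N / (e * M (N + 1))`. -/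
theorem bang_step {F : ℕ → ℝ → ℝ} {M : ℕ → ℝ} (hM : ∀ n, 0 < M n)
    (hmono : Antitone fun n => M n / M (n + 1))
    (hF : ∀ n t, HasDerivAt (F n) (F (n + 1) t) t) (hb : ∀ n t, |F n t| ≤ M n) (N : ℕ) {x : ℝ}
    (hx : ∀ j, |F j x| ≤ Real.exp ((j : ℝ) - (N + 1 : ℕ)) * M j) {y : ℝ} (hxy : x ≤ y)
    (hy : y ≤ x + Real.exp (-1) * (M N / M (N + 1))) (j : ℕ) :
    |F j y| ≤ Real.exp ((j : ℝ) - N) * M j := by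
  set R := M (N + 1) / M N with hR
  have hR0 : 0 < R := div_pos (hM _) (hM _)
  -- Downward induction on j. For j ≥ N + 1 the global bound suffices, the exponential prefactor
  -- being at least 1. Below that, passing from j to j + 1 costs e in the prefactor and, by
  -- log-convexity, at most R in M; hence the growth rate e * R.
  have key : ∀ k j : ℕ, N + 1 ≤ j + k → ∀ z, x ≤ z →
      |F j z| ≤ Real.exp ((j : ℝ) - (N + 1 : ℕ)) * M j * Real.exp (Real.exp 1 * R * (z - x)) := by
    intro k
    induction k with
    | zero =>
      intro j hj z hz
      refine (hb j z).trans ?_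
      have h1 : 1 ≤ Real.exp ((j : ℝ) - (N + 1 : ℕ)) :=
        Real.one_le_exp (sub_nonneg.2 (by exact_mod_cast hj))
      have h2 : 1 ≤ Real.exp (Real.exp 1 * R * (z - x)) :=
        Real.one_le_exp (mul_nonneg (by positivity) (sub_nonneg.2 hz))
      nlinarith [hM j, mul_le_mul h1 h2 zero_le_one (by positivity)]
    | succ k ih =>
      intro j hj z hz
      by_cases hjN : N + 1 ≤ j + k
      · exact ih j hjN z hz
      have hjN' : j ≤ N := by omega
      have hMj : M (j + 1) ≤ R * M j := by
        have h := hmono hjN'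
        simp only at h
        rw [div_le_div_iff₀ (hM _) (hM _)] at h
        rw [hR, div_mul_eq_mul_div, le_div_iff₀ (hM _)]
        linarith
      set A := Real.exp ((j : ℝ) - (N + 1 : ℕ)) * M j with hA
      have hB : ∀ w : ℝ, HasDerivAt (fun w => A * Real.exp (Real.exp 1 * R * (w - x)))
          (A * (Real.exp (Real.exp 1 * R * (w - x)) * (Real.exp 1 * R))) w := by
        intro w
        have h1 : HasDerivAt (fun w : ℝ => Real.exp 1 * R * (w - x)) (Real.exp 1 * R) w := by
          simpa using ((hasDerivAt_id w).sub_const x).const_mul (Real.exp 1 * R)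
        exact h1.exp.const_mul A
      have := image_norm_le_of_norm_deriv_right_le_deriv_boundary (f := F j) (f' := F (j + 1))
        (a := x) (b := z) (fun w _ => (hF j w).continuousAt.continuousWithinAt)
        (fun w _ => (hF j w).hasDerivWithinAt) (by simpa [hA] using hx j) hB
        (fun w hw => by
          rw [Real.norm_eq_abs]
          refine (ih (j + 1) (by omega) w hw.1).trans ?_
          have he : Real.exp (((j + 1 : ℕ) : ℝ) - (N + 1 : ℕ)) =
              Real.exp ((j : ℝ) - (N + 1 : ℕ)) * Real.exp 1 := by
            rw [← Real.exp_add]; push_cast; ring_nf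
          rw [he, hA]
          calc _ ≤ Real.exp ((j : ℝ) - (N + 1 : ℕ)) * Real.exp 1 * (R * M j) *
                Real.exp (Real.exp 1 * R * (w - x)) := by gcongr
            _ = _ := by ring)
      exact this (Set.right_mem_Icc.2 hz)
  refine (key (N + 1) j (by omega) y hxy).trans ?_
  -- The step length is 1/(e * R), so the growth factor is at most e: one unit of N.
  have h1 : Real.exp 1 * R * (y - x) ≤ 1 := by
    have h2 : y - x ≤ Real.exp (-1) * (M N / M (N + 1)) := by linarith
    have h3 : Real.exp 1 * R * (Real.exp (-1) * (M N / M (N + 1))) = 1 := by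
      rw [hR, Real.exp_neg]
      have := (hM N).ne'
      have := (hM (N + 1)).ne'
      field_simp
    calc _ ≤ Real.exp 1 * R * (Real.exp (-1) * (M N / M (N + 1))) := by gcongr
      _ = 1 := h3
  calc _ ≤ Real.exp ((j : ℝ) - (N + 1 : ℕ)) * M j * Real.exp 1 := by
        have := (hM j).le
        gcongr
    _ = Real.exp ((j : ℝ) - N) * M j := by
        rw [mul_right_comm, ← Real.exp_add]; push_cast; ring_nf

/-- **Denjoy–Carleman theorem** (Bang's form): a function all of whose derivatives vanish at `0`,
with `n`-th derivative bounded by a log-convex sequence `M n` such that `∑ M n / M (n + 1) = ∞`,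
vanishes on `[0, ∞)`. -/
theorem denjoy_carleman {F : ℕ → ℝ → ℝ} {M : ℕ → ℝ} (hM : ∀ n, 0 < M n)
    (hmono : Antitone fun n => M n / M (n + 1))
    (hF : ∀ n t, HasDerivAt (F n) (F (n + 1) t) t) (hb : ∀ n t, |F n t| ≤ M n)
    (h0 : ∀ n, F n 0 = 0) (hdiv : ¬ Summable fun n => M n / M (n + 1)) (n : ℕ) {t : ℝ}
    (ht : 0 ≤ t) : F n t = 0 := by
  set a : ℕ → ℝ := fun n => Real.exp (-1) * (M n / M (n + 1)) with ha
  have ha0 : ∀ n, 0 ≤ a n := fun n => by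
    have := hM n; have := hM (n + 1); positivity
  -- From 0, where flatness gives any bound, m steps of lengths a (k+m-1), ..., a k are made, each
  -- losing a factor e; the exponent k survives. Divergence of every tail of a lets k be fixed first
  -- and t reached afterwards.
  have main : ∀ m k : ℕ, ∀ x, 0 ≤ x → x ≤ ∑ i ∈ Finset.range m, a (k + i) → ∀ j,
      |F j x| ≤ Real.exp ((j : ℝ) - k) * M j := by
    intro m
    induction m with
    | zero =>
      intro k x hx hx' j
      have : x = 0 := le_antisymm (by simpa using hx') hx
      rw [this, h0, abs_zero]
      have := hM j
      positivity
    | succ m ih =>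
      intro k x hx hx' j
      rw [Finset.sum_range_succ'] at hx'
      have hx'' : x - a k ≤ ∑ i ∈ Finset.range m, a (k + 1 + i) := by
        simp only [add_zero] at hx'
        have : ∀ i, a (k + (i + 1)) = a (k + 1 + i) := fun i => by congr 1; ring
        simp only [this] at hx'
        linarith
      rcases le_total x (a k) with hxa | hxa
      · refine bang_step hM hmono hF hb k (x := 0) (fun i => ?_) hx (by simpa using hxa) j
        rw [h0, abs_zero]
        have := hM i
        positivity
      · exact bang_step hM hmono hF hb k (ih (k + 1) (x - a k) (by linarith) hx'')
          (by linarith [ha0 k]) (by simp only [ha]; linarith) j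
  have hdiv' : ∀ k, ¬ Summable fun i => a (k + i) := by
    intro k hs
    have h1 : Summable a := by
      rw [← summable_nat_add_iff k]
      simpa [add_comm] using hs
    exact hdiv ((summable_mul_left_iff (Real.exp_pos _).ne').1 h1)
  have hle : ∀ k : ℕ, |F n t| ≤ Real.exp ((n : ℝ) - k) * M n := by
    intro k
    have ht1 := (not_summable_iff_tendsto_nat_atTop_of_nonneg (fun i => ha0 (k + i))).1 (hdiv' k)
    obtain ⟨m, hm⟩ := (ht1.eventually_ge_atTop t).exists
    exact main m k t ht hm n
  have hlim : Tendsto (fun k : ℕ => Real.exp ((n : ℝ) - k) * M n) atTop (nhds 0) := by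
    have h1 : Tendsto (fun k : ℕ => (n : ℝ) - k) atTop atBot := by
      simpa [sub_eq_add_neg] using tendsto_atBot_add_const_left atTop (n : ℝ)
        (tendsto_neg_atTop_atBot.comp (tendsto_natCast_atTop_atTop (R := ℝ)))
    simpa using (Real.tendsto_exp_atBot.comp h1).mul_const (M n)
  exact abs_nonpos_iff.1 (ge_of_tendsto' hlim hle)

/-! ### Carleman's inequality -/

/-- The product telescopes. The weights are chosen so that the first n + 1 of them have geometric
mean n + 2. -/
theorem prod_carleman_weights (n : ℕ) :
    ∏ k ∈ Finset.range n, (((k : ℝ) + 2) ^ (k + 1) / ((k : ℝ) + 1) ^ k) = ((n : ℝ) + 1) ^ n := by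
  induction n with
  | zero => simp
  | succ n ih =>
    rw [Finset.prod_range_succ, ih]
    have : (n : ℝ) + 1 ≠ 0 := by positivity
    push_cast
    field_simp
    ring

/-- **Carleman's inequality** for finite sums. -/
theorem carleman_inequality {a : ℕ → ℝ} (ha : ∀ n, 0 ≤ a n) (N : ℕ) :
    ∑ n ∈ Finset.range N, (∏ k ∈ Finset.range (n + 1), a k) ^ (1 / ((n : ℝ) + 1)) ≤
      Real.exp 1 * ∑ k ∈ Finset.range N, a k := by
  set c : ℕ → ℝ := fun k => ((k : ℝ) + 2) ^ (k + 1) / ((k : ℝ) + 1) ^ k with hc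
  have hc0 : ∀ k, 0 < c k := fun k => by positivity
  -- AM–GM for a k * c k, divided by n + 2. Writing 1/((n+1)(n+2)) as a difference makes the later
  -- sum over n telescope.
  have hterm : ∀ n : ℕ, (∏ k ∈ Finset.range (n + 1), a k) ^ (1 / ((n : ℝ) + 1)) ≤
      ∑ k ∈ Finset.range (n + 1), a k * c k * (1 / ((n : ℝ) + 1) - 1 / ((n : ℝ) + 2)) := by
    intro n
    have h1 : (0 : ℝ) < (n : ℝ) + 1 := by positivity
    have hg := Real.geom_mean_le_arith_mean_weighted (Finset.range (n + 1))
      (fun _ => 1 / ((n : ℝ) + 1)) (fun k => a k * c k) (fun _ _ => by positivity)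
      (by simp; field_simp) (fun k _ => mul_nonneg (ha k) (hc0 k).le)
    rw [Real.finsetProd_rpow _ _ (fun k _ => mul_nonneg (ha k) (hc0 k).le),
      Finset.prod_mul_distrib, Real.mul_rpow (Finset.prod_nonneg fun k _ => ha k)
        (Finset.prod_nonneg fun k _ => (hc0 k).le), prod_carleman_weights] at hg
    have h2 : ((((n + 1 : ℕ) : ℝ) + 1) ^ (n + 1)) ^ (1 / ((n : ℝ) + 1)) = (n : ℝ) + 2 := by
      have := Real.pow_rpow_inv_natCast (x := ((n + 1 : ℕ) : ℝ) + 1) (n := n + 1)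
        (by positivity) (by omega)
      push_cast at this ⊢
      rw [one_div, this]; ring
    rw [h2, ← le_div_iff₀ (by positivity), Finset.sum_div] at hg
    refine hg.trans (le_of_eq (Finset.sum_congr rfl fun k _ => ?_))
    field_simp
    ring
  calc _ ≤ ∑ n ∈ Finset.range N, ∑ k ∈ Finset.range (n + 1),
        a k * c k * (1 / ((n : ℝ) + 1) - 1 / ((n : ℝ) + 2)) :=
        Finset.sum_le_sum fun n _ => hterm n
    _ = ∑ k ∈ Finset.range N, ∑ n ∈ Finset.Ico k N,
        a k * c k * (1 / ((n : ℝ) + 1) - 1 / ((n : ℝ) + 2)) := by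
        refine Finset.sum_comm' fun n k => ?_
        simp only [Finset.mem_range, Finset.mem_Ico]
        omega
    _ ≤ ∑ k ∈ Finset.range N, Real.exp 1 * a k := by
        refine Finset.sum_le_sum fun k hk => ?_
        rw [← Finset.mul_sum]
        have htel : ∑ n ∈ Finset.Ico k N, (1 / ((n : ℝ) + 1) - 1 / ((n : ℝ) + 2)) ≤
            1 / ((k : ℝ) + 1) := by
          have h := Finset.sum_Ico_sub (fun n : ℕ => -(1 / ((n : ℝ) + 1)))
            (Finset.mem_range.1 hk).le
          have h' : ∑ n ∈ Finset.Ico k N, (1 / ((n : ℝ) + 1) - 1 / ((n : ℝ) + 2)) =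
              -(1 / ((N : ℝ) + 1)) - -(1 / ((k : ℝ) + 1)) := by
            rw [← h]
            refine Finset.sum_congr rfl fun n _ => ?_
            push_cast
            ring
          have : 0 ≤ 1 / ((N : ℝ) + 1) := by positivity
          linarith
        have hck : c k * (1 / ((k : ℝ) + 1)) ≤ Real.exp 1 := by
          have h1 : c k * (1 / ((k : ℝ) + 1)) = (1 / ((k : ℝ) + 1) + 1) ^ (k + 1) := by
            simp only [hc]
            have h2 : 1 / ((k : ℝ) + 1) + 1 = ((k : ℝ) + 2) / ((k : ℝ) + 1) := by
              field_simp; ring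
            rw [h2, div_pow]
            field_simp
            ring
          rw [h1]
          calc _ ≤ Real.exp (1 / ((k : ℝ) + 1)) ^ (k + 1) := by
                gcongr
                exact Real.add_one_le_exp _
            _ = Real.exp 1 := by
                rw [← Real.exp_nat_mul]
                congr 1
                push_cast
                field_simp
        calc _ ≤ a k * c k * (1 / ((k : ℝ) + 1)) :=
              mul_le_mul_of_nonneg_left htel (mul_nonneg (ha k) (hc0 k).le)
          _ = a k * (c k * (1 / ((k : ℝ) + 1))) := by ring
          _ ≤ a k * Real.exp 1 := mul_le_mul_of_nonneg_left hck (ha k)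
          _ = _ := mul_comm _ _
    _ = _ := by rw [← Finset.mul_sum]

/-! ### Moment inequalities on the half-line -/

namespace IsStieltjesLaw

variable {μ ν : Measure ℝ}

theorem ae_nonneg (h : IsStieltjesLaw μ) : ∀ᵐ x ∂μ, 0 ≤ x := by
  rw [ae_iff]
  simpa [Set.Iio] using h.nonneg

theorem integral_pow_zero (h : IsStieltjesLaw μ) : ∫ x, x ^ 0 ∂μ = 1 := by
  have := h.isProbabilityMeasure
  simp

/-- Cauchy–Schwarz, from integrating x^n (a x - b)² ≥ 0; support in [0, ∞) is needed for odd n. -/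
theorem sq_integral_pow_le (h : IsStieltjesLaw μ) {n : ℕ} (hn : 0 < ∫ x, x ^ n ∂μ) :
    (∫ x, x ^ (n + 1) ∂μ) ^ 2 ≤ (∫ x, x ^ n ∂μ) * ∫ x, x ^ (n + 2) ∂μ := by
  set a := ∫ x, x ^ n ∂μ with ha
  set b := ∫ x, x ^ (n + 1) ∂μ with hb
  set c := ∫ x, x ^ (n + 2) ∂μ with hc
  have h0 : 0 ≤ ∫ x, x ^ n * (a * x - b) ^ 2 ∂μ := by
    refine integral_nonneg_of_ae ?_
    filter_upwards [h.ae_nonneg] with x hx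
    simp only [Pi.zero_apply]
    positivity
  have h1 : ∫ x, x ^ n * (a * x - b) ^ 2 ∂μ = a ^ 2 * c - 2 * a * b * b + b ^ 2 * a := by
    have h2 : ∀ x : ℝ, x ^ n * (a * x - b) ^ 2 =
        a ^ 2 * x ^ (n + 2) - 2 * a * b * x ^ (n + 1) + b ^ 2 * x ^ n := fun x => by ring
    simp only [h2]
    have h3 : Integrable (fun x => a ^ 2 * x ^ (n + 2) - 2 * a * b * x ^ (n + 1)) μ :=
      ((h.integrable_pow _).const_mul _).sub ((h.integrable_pow _).const_mul _)
    rw [integral_add h3 ((h.integrable_pow _).const_mul _), integral_sub ((h.integrable_pow _).const_mul _)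
      ((h.integrable_pow _).const_mul _), integral_const_mul, integral_const_mul,
      integral_const_mul]
  rw [h1] at h0
  have h3 : 0 ≤ a * (a * c - b ^ 2) := by linarith
  have := nonneg_of_mul_nonneg_right h3 hn
  linarith

theorem integrable_sqrt_pow (h : IsStieltjesLaw μ) (n : ℕ) :
    Integrable (fun x => √x ^ n) μ := by
  have := h.isProbabilityMeasure
  refine ((integrable_const (1 : ℝ)).add (h.integrable_pow n)).mono'
    (by fun_prop) ?_
  filter_upwards [h.ae_nonneg] with x hx
  have h1 : (√x ^ n) ^ 2 = x ^ n := by rw [← pow_mul, mul_comm, pow_mul, Real.sq_sqrt hx]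
  rw [Real.norm_of_nonneg (by positivity), Pi.add_apply, ← h1]
  nlinarith [sq_nonneg (√x ^ n - 1), Real.sqrt_nonneg x]

/-- The variance of √x ^ n is non-negative. -/
theorem integral_sqrt_pow_le (h : IsStieltjesLaw μ) (n : ℕ) :
    ∫ x, √x ^ n ∂μ ≤ √(∫ x, x ^ n ∂μ) := by
  have := h.isProbabilityMeasure
  refine Real.le_sqrt_of_sq_le ?_
  set t := ∫ x, √x ^ n ∂μ with ht
  have h0 : 0 ≤ ∫ x, (√x ^ n - t) ^ 2 ∂μ := integral_nonneg fun x => sq_nonneg _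
  have h1 : ∫ x, (√x ^ n - t) ^ 2 ∂μ = (∫ x, x ^ n ∂μ) - 2 * t * t + t ^ 2 := by
    have h2 : ∀ᵐ x ∂μ, (√x ^ n - t) ^ 2 = x ^ n - 2 * t * √x ^ n + t ^ 2 := by
      filter_upwards [h.ae_nonneg] with x hx
      have h1 : (√x ^ n) ^ 2 = x ^ n := by rw [← pow_mul, mul_comm, pow_mul, Real.sq_sqrt hx]
      rw [← h1]; ring
    have h3 : Integrable (fun x => x ^ n - 2 * t * √x ^ n) μ :=
      (h.integrable_pow _).sub ((h.integrable_sqrt_pow _).const_mul _)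
    rw [integral_congr_ae h2, integral_add h3 (integrable_const _),
      integral_sub (h.integrable_pow _) ((h.integrable_sqrt_pow _).const_mul _),
      integral_const_mul]
    simp [← ht]
  rw [h1] at h0
  linarith

end IsStieltjesLaw

/-! ### The cosine transform and Carleman's criterion -/

/-- The `n`-th derivative at `t` of `s ↦ ∫ cos (s √x) dμ(x)`. -/
noncomputable def cosMoment (μ : Measure ℝ) (n : ℕ) (t : ℝ) : ℝ :=
  ∫ x, √x ^ n * Real.cos (t * √x + n * (Real.pi / 2)) ∂μ

theorem abs_sqrt_pow_mul_cos_le (n : ℕ) (x s : ℝ) : ‖√x ^ n * Real.cos s‖ ≤ √x ^ n := by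
  rw [norm_mul, Real.norm_of_nonneg (by positivity), Real.norm_eq_abs]
  exact mul_le_of_le_one_right (by positivity) (Real.abs_cos_le_one _)

namespace IsStieltjesLaw

variable {μ ν : Measure ℝ}

theorem integrable_sqrt_pow_mul_cos (h : IsStieltjesLaw μ) (n : ℕ) (t : ℝ) :
    Integrable (fun x => √x ^ n * Real.cos (t * √x + n * (Real.pi / 2))) μ :=
  (h.integrable_sqrt_pow n).mono' (by fun_prop)
    (Eventually.of_forall fun _ => abs_sqrt_pow_mul_cos_le _ _ _)

theorem abs_cosMoment_le (h : IsStieltjesLaw μ) (n : ℕ) (t : ℝ) :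
    |cosMoment μ n t| ≤ √(∫ x, x ^ n ∂μ) :=
  (norm_integral_le_of_norm_le (h.integrable_sqrt_pow n)
    (Eventually.of_forall fun _ => abs_sqrt_pow_mul_cos_le _ _ _)).trans
    (h.integral_sqrt_pow_le n)

theorem hasDerivAt_cosMoment (h : IsStieltjesLaw μ) (n : ℕ) (t : ℝ) :
    HasDerivAt (cosMoment μ n) (cosMoment μ (n + 1) t) t := by
  refine (hasDerivAt_integral_of_dominated_loc_of_deriv_le
    (F := fun t x => √x ^ n * Real.cos (t * √x + n * (Real.pi / 2)))
    (F' := fun t x => √x ^ (n + 1) * Real.cos (t * √x + (n + 1 : ℕ) * (Real.pi / 2)))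
    (bound := fun x => √x ^ (n + 1)) (s := Set.univ) Filter.univ_mem
    (Eventually.of_forall fun t => (h.integrable_sqrt_pow_mul_cos n t).1)
    (h.integrable_sqrt_pow_mul_cos n t) (h.integrable_sqrt_pow_mul_cos (n + 1) t).1
    (Eventually.of_forall fun _ _ _ => abs_sqrt_pow_mul_cos_le _ _ _)
    (h.integrable_sqrt_pow (n + 1)) (Eventually.of_forall fun x t _ => ?_)).2
  have h1 : HasDerivAt (fun s : ℝ => s * √x + n * (Real.pi / 2)) (√x) t := by
    simpa using ((hasDerivAt_id t).mul_const (√x)).add_const ((n : ℝ) * (Real.pi / 2))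
  refine (h1.cos.const_mul (√x ^ n)).congr_deriv ?_
  have h2 : t * √x + ((n + 1 : ℕ) : ℝ) * (Real.pi / 2) =
      t * √x + n * (Real.pi / 2) + Real.pi / 2 := by push_cast; ring
  rw [h2, Real.cos_add_pi_div_two]
  ring

/-- Odd orders vanish with the cosine, so only integer moments enter and the rounding in n / 2 is
harmless. -/
theorem cosMoment_zero_right (h : IsStieltjesLaw μ) (n : ℕ) :
    cosMoment μ n 0 = Real.cos (n * (Real.pi / 2)) * ∫ x, x ^ (n / 2) ∂μ := by
  have h0 : cosMoment μ n 0 = Real.cos (n * (Real.pi / 2)) * ∫ x, √x ^ n ∂μ := by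
    rw [← integral_const_mul]
    simp [cosMoment, mul_comm]
  rw [h0]
  obtain ⟨k, rfl | rfl⟩ := n.even_or_odd'
  · congr 1
    refine integral_congr_ae ?_
    filter_upwards [h.ae_nonneg] with x hx
    rw [pow_mul, Real.sq_sqrt hx, Nat.mul_div_cancel_left _ two_pos]
  · have : Real.cos (((2 * k + 1 : ℕ) : ℝ) * (Real.pi / 2)) = 0 :=
      Real.cos_eq_zero_iff.2 ⟨k, by push_cast; ring⟩
    rw [this, zero_mul, zero_mul]

/-- A law on `[0, ∞)` is determined by the cosine transform of the law of its square root. -/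
theorem ext_of_cosMoment (hμ : IsStieltjesLaw μ) (hν : IsStieltjesLaw ν)
    (h : ∀ t, 0 ≤ t → cosMoment ν 0 t = cosMoment μ 0 t) : ν = μ := by
  have := hμ.isProbabilityMeasure
  have := hν.isProbabilityMeasure
  have hm1 : Measurable fun x : ℝ => √x := by fun_prop
  have hm2 : Measurable fun x : ℝ => -√x := by fun_prop
  -- The symmetrised law of ±√x, of total mass 2, has an even real characteristic function, so t ≥ 0
  -- suffices. Squaring then undoes the symmetrisation.
  have hchar : ∀ ρ : Measure ℝ, IsStieltjesLaw ρ → ∀ t,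
      charFun (ρ.map (fun x => √x) + ρ.map (fun x => -√x)) t =
        ((2 * cosMoment ρ 0 |t| : ℝ) : ℂ) := by
    intro ρ hρ t
    have := hρ.isProbabilityMeasure
    have hb : ∀ s : ℝ → ℝ, Measurable s →
        Integrable (fun x => Complex.exp (s x * Complex.I)) ρ := fun s hs =>
      (integrable_const (1 : ℝ)).mono' (by fun_prop)
        (Eventually.of_forall fun x => by simp)
    have e1 : ∀ s : ℝ → ℝ, Measurable s → charFun (ρ.map s) t =
        ∫ x, Complex.exp ((t * s x : ℝ) * Complex.I) ∂ρ := by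
      intro s hs
      rw [charFun_apply_real, integral_map hs.aemeasurable (by fun_prop)]
      push_cast
      rfl
    have : IsProbabilityMeasure (ρ.map fun x => √x) :=
      Measure.isProbabilityMeasure_map hm1.aemeasurable
    have : IsProbabilityMeasure (ρ.map fun x => -√x) :=
      Measure.isProbabilityMeasure_map hm2.aemeasurable
    have hadd : charFun (ρ.map (fun x => √x) + ρ.map (fun x => -√x)) t =
        charFun (ρ.map (fun x => √x)) t + charFun (ρ.map (fun x => -√x)) t := by
      simp only [charFun]
      refine integral_add_measure ?_ ?_ <;>
      exact (integrable_const (1 : ℝ)).mono' (by fun_prop)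
        (Eventually.of_forall fun x => by
          simpa using (Complex.norm_exp_ofReal_mul_I (t * x)).le)
    rw [hadd, e1 _ hm1, e1 _ hm2,
      ← integral_add (hb (fun x => t * √x) (by fun_prop)) (hb (fun x => t * -√x) (by fun_prop)),
      cosMoment, ← integral_const_mul, ← integral_complex_ofReal]
    refine integral_congr_ae (Eventually.of_forall fun x => ?_)
    have hc : Real.cos (|t| * √x) = Real.cos (t * √x) := by
      rcases abs_choice t with h | h <;> rw [h]
      rw [neg_mul, Real.cos_neg]
    simp only [pow_zero, Nat.cast_zero, zero_mul, add_zero, one_mul, hc]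
    push_cast
    rw [Complex.two_cos]
    ring_nf
  have hsq : ∀ ρ : Measure ℝ, IsStieltjesLaw ρ →
      (ρ.map (fun x => √x) + ρ.map (fun x => -√x)).map (fun y => y ^ 2) = (2 : ENNReal) • ρ := by
    intro ρ hρ
    have hq : Measurable fun y : ℝ => y ^ 2 := by fun_prop
    have hid : ∀ s : ℝ → ℝ, Measurable s → (∀ x, 0 ≤ x → s x ^ 2 = x) →
        (ρ.map s).map (fun y => y ^ 2) = ρ := by
      intro s hs hsx
      rw [Measure.map_map hq hs]
      conv_rhs => rw [← Measure.map_id (μ := ρ)]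
      refine Measure.map_congr ?_
      filter_upwards [hρ.ae_nonneg] with x hx
      exact hsx x hx
    rw [Measure.map_add _ _ hq, hid _ hm1 fun x hx => Real.sq_sqrt hx,
      hid _ hm2 fun x hx => by rw [neg_sq, Real.sq_sqrt hx], two_smul]
  have heq : ν.map (fun x => √x) + ν.map (fun x => -√x) =
      μ.map (fun x => √x) + μ.map (fun x => -√x) := by
    refine Measure.ext_of_charFun (funext fun t => ?_)
    rw [hchar ν hν, hchar μ hμ, h _ (abs_nonneg t)]
  have h2 : (2 : ENNReal) • ν = (2 : ENNReal) • μ := by rw [← hsq ν hν, heq, hsq μ hμ]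
  ext s hs
  have h3 := congrArg (fun ρ : Measure ℝ => ρ s) h2
  simp only [Measure.smul_apply, smul_eq_mul] at h3
  exact (ENNReal.mul_right_inj (by simp) (by simp)).1 h3

/-- **Carleman's criterion** in the Stieltjes case. -/
theorem isMDeterminate_of_carleman (hμ : IsStieltjesLaw μ) (hpos : ∀ n, 0 < ∫ x, x ^ n ∂μ)
    (hC : CarlemanCondition fun n => ∫ x, x ^ n ∂μ) : IsMDeterminate μ := by
  refine ⟨hμ, fun ν hν hmom => ?_⟩
  have hmom' : ∀ n, ∫ x, x ^ n ∂ν = ∫ x, x ^ n ∂μ := by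
    intro n
    rcases n.eq_zero_or_pos with rfl | hn
    · rw [hμ.integral_pow_zero, hν.integral_pow_zero]
    · exact hmom n hn
  set m : ℕ → ℝ := fun n => ∫ x, x ^ n ∂μ with hm
  -- The 2 accounts for the difference of two transforms; it cancels in the ratios.
  set M : ℕ → ℝ := fun n => 2 * √(m n) with hMdef
  have hs : ∀ n, 0 < √(m n) := fun n => Real.sqrt_pos.2 (hpos n)
  have hM : ∀ n, 0 < M n := fun n => mul_pos two_pos (hs n)
  have hratio : ∀ n, M n / M (n + 1) = √(m n) / √(m (n + 1)) := fun n => by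
    rw [hMdef]; exact mul_div_mul_left _ _ two_ne_zero
  have hmono : Antitone fun n => M n / M (n + 1) := by
    refine antitone_nat_of_succ_le fun n => ?_
    rw [hratio, hratio, ← Real.sqrt_div (hpos _).le, ← Real.sqrt_div (hpos _).le]
    refine Real.sqrt_le_sqrt ?_
    rw [div_le_div_iff₀ (hpos _) (hpos _), ← sq]
    exact hμ.sq_integral_pow_le (hpos n)
  have hdiv : ¬ Summable fun n => M n / M (n + 1) := by
    intro hsum
    have ha0 : ∀ n, 0 ≤ M n / M (n + 1) := fun n => (div_pos (hM _) (hM _)).le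
    -- Since m 0 = 1, the geometric means of the ratios are exactly the terms of Carleman's series.
    have hprod : ∀ n, ∏ k ∈ Finset.range n, M k / M (k + 1) = 1 / √(m n) := by
      intro n
      induction n with
      | zero => simp [show m 0 = 1 from hμ.integral_pow_zero]
      | succ n ih =>
        rw [Finset.prod_range_succ, ih, hratio]
        have := (hs n).ne'
        field_simp
    have hbound : ∀ N : ℕ, ∑ n ∈ Finset.Icc 1 N, m n ^ (-(1 / (2 * (n : ℝ)))) ≤
        Real.exp 1 * ∑' n, M n / M (n + 1) := by
      intro N
      calc _ = ∑ n ∈ Finset.range N,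
            (∏ k ∈ Finset.range (n + 1), M k / M (k + 1)) ^ (1 / ((n : ℝ) + 1)) := by
            rw [← Finset.Ico_add_one_right_eq_Icc, Finset.sum_Ico_eq_sum_range]
            refine Finset.sum_congr (by simp) fun n _ => ?_
            rw [hprod, add_comm 1 n, one_div (√_), Real.sqrt_eq_rpow, ← Real.rpow_neg (hpos _).le,
              ← Real.rpow_mul (hpos _).le]
            congr 1
            push_cast
            field_simp
        _ ≤ Real.exp 1 * ∑ k ∈ Finset.range N, M k / M (k + 1) := carleman_inequality ha0 N
        _ ≤ _ := by
            gcongr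
            exact hsum.sum_le_tsum _ fun n _ => ha0 n
    obtain ⟨N, hN⟩ := (hC.eventually_gt_atTop (Real.exp 1 * ∑' n, M n / M (n + 1))).exists
    exact absurd hN (hbound N).not_gt
  refine ext_of_cosMoment hμ hν fun t ht => sub_eq_zero.1 ?_
  refine denjoy_carleman (F := fun n t => cosMoment ν n t - cosMoment μ n t) hM hmono
    (fun n t => (hν.hasDerivAt_cosMoment n t).sub (hμ.hasDerivAt_cosMoment n t))
    (fun n t => ?_) (fun n => ?_) hdiv 0 ht
  · have h1 := hν.abs_cosMoment_le n t
    rw [hmom'] at h1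
    have h2 := hμ.abs_cosMoment_le n t
    refine (abs_sub _ _).trans ?_
    simp only [hMdef, hm]
    linarith
  · simp only [hν.cosMoment_zero_right, hμ.cosMoment_zero_right, hmom', sub_self]

end IsStieltjesLaw

/-! ### Bounds for K_n(r) -/

/-- The tangent to log at 1 + n bounds 1 + log (1 + x) by L * exp (x / (2(1+n))). Its n-th power
spends only half of the decay exp (-x). -/
theorem log_one_add_rpow_mul_exp_le {r : ℝ} (hr : r ∈ Set.Icc (0 : ℝ) 1) (n : ℕ) {x : ℝ}
    (hx : 0 ≤ x) :
    Real.log (1 + x) ^ ((n : ℝ) * r) * Real.exp (-x) ≤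
      (2 + Real.log (1 + n)) ^ n * Real.exp (-(1 / 2) * x) := by
  have hlog : 0 ≤ Real.log (1 + x) := Real.log_nonneg (by linarith)
  set L := 2 + Real.log (1 + n) with hL
  have hL2 : 2 ≤ L := by
    have : 0 ≤ Real.log (1 + (n : ℝ)) := Real.log_nonneg (by simp)
    linarith
  have hn1 : (0 : ℝ) < 1 + n := by positivity
  have h1 : Real.log (1 + x) ^ ((n : ℝ) * r) ≤ (1 + Real.log (1 + x)) ^ n := by
    calc _ ≤ (1 + Real.log (1 + x)) ^ ((n : ℝ) * r) :=
          Real.rpow_le_rpow hlog (by linarith) (mul_nonneg n.cast_nonneg hr.1)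
      _ ≤ (1 + Real.log (1 + x)) ^ (n : ℝ) :=
          Real.rpow_le_rpow_of_exponent_le (by linarith)
            (mul_le_of_le_one_right n.cast_nonneg hr.2)
      _ = _ := Real.rpow_natCast _ _
  have h2 : Real.log (1 + x) ≤ Real.log (1 + n) + x / (1 + n) := by
    have h := Real.log_le_sub_one_of_pos (x := (1 + x) / (1 + n)) (by positivity)
    rw [Real.log_div (by positivity) hn1.ne'] at h
    have h' : (1 + x) / (1 + n) - 1 ≤ x / (1 + n) := by
      rw [add_div, div_eq_mul_one_div 1, one_mul]
      have : 1 / (1 + (n : ℝ)) ≤ 1 := by rw [div_le_one hn1]; simp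
      linarith
    linarith
  have h3 : 1 + Real.log (1 + x) ≤ L * Real.exp (x / (2 * (1 + n))) := by
    have h := Real.add_one_le_exp (x / (2 * (1 + n)))
    have h' : x / (1 + n) ≤ L * (x / (2 * (1 + n))) := by
      calc x / (1 + n) = 2 * (x / (2 * (1 + n))) := by field_simp
        _ ≤ _ := by gcongr
    nlinarith
  have h4 : (1 + Real.log (1 + x)) ^ n ≤ L ^ n * Real.exp (x / 2) := by
    calc _ ≤ (L * Real.exp (x / (2 * (1 + n)))) ^ n := by gcongr
      _ = L ^ n * Real.exp (n * (x / (2 * (1 + n)))) := by rw [mul_pow, Real.exp_nat_mul]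
      _ ≤ _ := by
          gcongr
          rw [mul_div_assoc', div_le_div_iff₀ (by positivity) two_pos]
          nlinarith
  calc _ ≤ L ^ n * Real.exp (x / 2) * Real.exp (-x) := by gcongr; exact h1.trans h4
    _ = _ := by rw [mul_assoc, ← Real.exp_add]; ring_nf

theorem log_one_add_rpow_mul_exp_nonneg (s : ℝ) {x : ℝ} (hx : 0 ≤ x) :
    0 ≤ Real.log (1 + x) ^ s * Real.exp (-x) :=
  mul_nonneg (Real.rpow_nonneg (Real.log_nonneg (by linarith)) _) (Real.exp_pos _).le

theorem integrableOn_logMoment {r : ℝ} (hr : r ∈ Set.Icc (0 : ℝ) 1) (n : ℕ) :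
    IntegrableOn (fun x => Real.log (1 + x) ^ ((n : ℝ) * r) * Real.exp (-x)) (Set.Ioi 0) := by
  refine ((integrableOn_exp_mul_Ioi (a := -(1 / 2)) (by norm_num) 0).const_mul
    ((2 + Real.log (1 + n)) ^ n)).mono' (by fun_prop) ?_
  refine ae_restrict_of_forall_mem measurableSet_Ioi fun x hx => ?_
  rw [Real.norm_of_nonneg (log_one_add_rpow_mul_exp_nonneg _ (le_of_lt hx))]
  exact log_one_add_rpow_mul_exp_le hr n (le_of_lt hx)

theorem logMoment_le {r : ℝ} (hr : r ∈ Set.Icc (0 : ℝ) 1) (n : ℕ) :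
    logMoment n r ≤ 2 * (2 + Real.log (1 + n)) ^ n := by
  have h := setIntegral_mono_on (integrableOn_logMoment hr n)
    ((integrableOn_exp_mul_Ioi (a := -(1 / 2)) (by norm_num) 0).const_mul
      ((2 + Real.log (1 + n)) ^ n)) measurableSet_Ioi
    fun x hx => log_one_add_rpow_mul_exp_le hr n (le_of_lt hx)
  rw [integral_const_mul, integral_exp_mul_Ioi (by norm_num)] at h
  refine h.trans (le_of_eq ?_)
  norm_num
  ring

/-- On (T, ∞) the logarithmic factor is at least its value at T, and the tail of exp (-x) has mass
exp (-T). -/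
theorem le_logMoment {r : ℝ} (hr : r ∈ Set.Icc (0 : ℝ) 1) (n : ℕ) {T : ℝ} (hT : 0 ≤ T) :
    Real.log (1 + T) ^ ((n : ℝ) * r) * Real.exp (-T) ≤ logMoment n r := by
  have hlog : 0 ≤ Real.log (1 + T) := Real.log_nonneg (by linarith)
  have hsub : Set.Ioi T ⊆ Set.Ioi (0 : ℝ) := Set.Ioi_subset_Ioi hT
  calc _ = ∫ x in Set.Ioi T, Real.log (1 + T) ^ ((n : ℝ) * r) * Real.exp (-x) := by
        rw [integral_const_mul, integral_exp_neg_Ioi]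
    _ ≤ ∫ x in Set.Ioi T, Real.log (1 + x) ^ ((n : ℝ) * r) * Real.exp (-x) := by
        refine setIntegral_mono_on ((integrableOn_exp_neg_Ioi T).const_mul _)
          ((integrableOn_logMoment hr n).mono_set hsub) measurableSet_Ioi fun x hx => ?_
        have hx' : T < x := hx
        gcongr
        exact mul_nonneg n.cast_nonneg hr.1
    _ ≤ _ := by
        refine setIntegral_mono_set (integrableOn_logMoment hr n) ?_ hsub.eventuallyLE
        exact ae_restrict_of_forall_mem measurableSet_Ioi fun x hx =>
          log_one_add_rpow_mul_exp_nonneg _ (le_of_lt hx)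

theorem logMoment_pos {r : ℝ} (hr : r ∈ Set.Icc (0 : ℝ) 1) (n : ℕ) : 0 < logMoment n r :=
  lt_of_lt_of_le (mul_pos (Real.rpow_pos_of_pos (Real.log_pos (by norm_num)) _)
    (Real.exp_pos _)) (le_logMoment hr n zero_le_one)

/-! ### The standard exponential law -/

theorem expMeasure_one_eq_withDensity :
    expMeasure 1 = (volume.restrict (Set.Ioi (0 : ℝ))).withDensity
      fun x => ENNReal.ofReal (Real.exp (-x)) := by
  rw [expMeasure, gammaMeasure, ← withDensity_indicator measurableSet_Ioi]
  refine withDensity_congr_ae ?_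
  have h0 : ∀ᵐ x : ℝ, x ≠ 0 := by simp [ae_iff]
  filter_upwards [h0] with x hx
  rw [show gammaPDF 1 1 x = exponentialPDF 1 x from rfl]
  rcases lt_or_gt_of_ne hx with h | h
  · rw [exponentialPDF_of_neg h, Set.indicator_of_notMem (by simpa using h.le)]
  · rw [exponentialPDF_of_nonneg h.le, Set.indicator_of_mem (by simpa using h)]
    simp

theorem integral_expMeasure_one (f : ℝ → ℝ) :
    ∫ x, f x ∂(expMeasure 1) = ∫ x in Set.Ioi 0, f x * Real.exp (-x) := by
  rw [expMeasure_one_eq_withDensity, integral_withDensity_eq_integral_toReal_smul (by fun_prop)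
    (by simp)]
  refine integral_congr_ae (Eventually.of_forall fun x => ?_)
  simp [ENNReal.toReal_ofReal (Real.exp_pos _).le, mul_comm]

theorem integrable_expMeasure_one {f : ℝ → ℝ}
    (hf : IntegrableOn (fun x => f x * Real.exp (-x)) (Set.Ioi 0)) :
    Integrable f (expMeasure 1) := by
  rw [expMeasure_one_eq_withDensity,
    integrable_withDensity_iff_integrable_smul' (by fun_prop) (by simp)]
  refine hf.congr (Eventually.of_forall fun x => ?_)
  simp [ENNReal.toReal_ofReal (Real.exp_pos _).le, mul_comm]

theorem ae_nonneg_expMeasure_one : ∀ᵐ x ∂(expMeasure 1), 0 ≤ x := by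
  rw [expMeasure_one_eq_withDensity]
  refine (withDensity_absolutelyContinuous _ _).ae_le ?_
  exact ae_restrict_of_forall_mem measurableSet_Ioi fun x hx => le_of_lt hx

theorem integrable_pow_expMeasure_one (n : ℕ) : Integrable (fun x => x ^ n) (expMeasure 1) := by
  refine integrable_expMeasure_one ?_
  have h := Real.GammaIntegral_convergent (s := n + 1) (by positivity)
  simpa [mul_comm] using h

theorem integral_pow_expMeasure_one (n : ℕ) : ∫ x, x ^ n ∂(expMeasure 1) = n.factorial := by
  rw [integral_expMeasure_one, ← Real.Gamma_nat_eq_factorial, Real.Gamma_eq_integral (by positivity)]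
  simp [mul_comm]

/-! ### Moments of the product variable -/

section ProductVar

variable {Ω : Type*} [MeasurableSpace Ω] {P : Measure Ω}
  {ξ₁ η₁ ξ₂ η₂ : Ω → ℝ} {r₁ r₂ : ℝ}

theorem ProbabilityTheory.HasLaw.ae_nonneg_of_expMeasure_one {X : Ω → ℝ}
    (hX : HasLaw X (expMeasure 1) P) : ∀ᵐ ω ∂P, 0 ≤ X ω :=
  ae_of_ae_map hX.aemeasurable (by rw [hX.map_eq]; exact ae_nonneg_expMeasure_one)

theorem productVar_ae_nonneg (hξ₁ : HasLaw ξ₁ (expMeasure 1) P) (hη₁ : HasLaw η₁ (expMeasure 1) P)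
    (hξ₂ : HasLaw ξ₂ (expMeasure 1) P) (hη₂ : HasLaw η₂ (expMeasure 1) P) :
    ∀ᵐ ω ∂P, 0 ≤ productVar ξ₁ η₁ ξ₂ η₂ r₁ r₂ ω := by
  filter_upwards [hξ₁.ae_nonneg_of_expMeasure_one, hη₁.ae_nonneg_of_expMeasure_one,
    hξ₂.ae_nonneg_of_expMeasure_one, hη₂.ae_nonneg_of_expMeasure_one] with ω h1 h2 h3 h4
  have h2' : 0 ≤ Real.log (1 + η₁ ω) := Real.log_nonneg (by linarith)
  have h4' : 0 ≤ Real.log (1 + η₂ ω) := Real.log_nonneg (by linarith)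
  unfold productVar
  positivity

theorem productVar_moment (hξ₁ : HasLaw ξ₁ (expMeasure 1) P) (hη₁ : HasLaw η₁ (expMeasure 1) P)
    (hξ₂ : HasLaw ξ₂ (expMeasure 1) P) (hη₂ : HasLaw η₂ (expMeasure 1) P)
    (hindep : iIndepFun ![ξ₁, η₁, ξ₂, η₂] P)
    (hr₁ : r₁ ∈ Set.Icc (0 : ℝ) 1) (hr₂ : r₂ ∈ Set.Icc (0 : ℝ) 1) (n : ℕ) :
    Integrable (fun ω => productVar ξ₁ η₁ ξ₂ η₂ r₁ r₂ ω ^ n) P ∧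
      moment (productVar ξ₁ η₁ ξ₂ η₂ r₁ r₂) n P =
        (n.factorial : ℝ) ^ 2 * logMoment n r₁ * logMoment n r₂ := by
  have : IsProbabilityMeasure (expMeasure 1) := isProbabilityMeasure_expMeasure one_pos
  have hlaw : HasLaw (fun ω i => (![ξ₁, η₁, ξ₂, η₂] : Fin 4 → Ω → ℝ) i ω)
      (Measure.pi fun _ : Fin 4 => expMeasure 1) P := by
    refine iIndepFun.hasLaw_pi (fun i => ?_) hindep
    fin_cases i <;> assumption
  set f : Fin 4 → ℝ → ℝ := ![fun x => x ^ n, fun x => Real.log (1 + x) ^ ((n : ℝ) * r₁),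
    fun x => x ^ n, fun x => Real.log (1 + x) ^ ((n : ℝ) * r₂)] with hf
  have hfi : ∀ i, Integrable (f i) (expMeasure 1) := by
    intro i
    fin_cases i
    · exact integrable_pow_expMeasure_one n
    · exact integrable_expMeasure_one (integrableOn_logMoment hr₁ n)
    · exact integrable_pow_expMeasure_one n
    · exact integrable_expMeasure_one (integrableOn_logMoment hr₂ n)
  have hint : Integrable (fun y : Fin 4 → ℝ => ∏ i, f i (y i))
      (Measure.pi fun _ : Fin 4 => expMeasure 1) := Integrable.fintype_prod hfi
  -- Merging the powers of the logarithm needs η₁, η₂ ≥ 0, which holds only almost surely.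
  have hae : (fun ω => productVar ξ₁ η₁ ξ₂ η₂ r₁ r₂ ω ^ n) =ᵐ[P]
      (fun y : Fin 4 → ℝ => ∏ i, f i (y i)) ∘
        fun ω i => (![ξ₁, η₁, ξ₂, η₂] : Fin 4 → Ω → ℝ) i ω := by
    filter_upwards [hη₁.ae_nonneg_of_expMeasure_one, hη₂.ae_nonneg_of_expMeasure_one] with ω h2 h4
    have h2' : 0 ≤ Real.log (1 + η₁ ω) := Real.log_nonneg (by linarith)
    have h4' : 0 ≤ Real.log (1 + η₂ ω) := Real.log_nonneg (by linarith)
    simp only [productVar, Function.comp, Fin.prod_univ_four, hf, mul_pow]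
    rw [← Real.rpow_mul_natCast h2', ← Real.rpow_mul_natCast h4', mul_comm r₁, mul_comm r₂]
    simp
    ring
  constructor
  · refine Integrable.congr ?_ hae.symm
    rw [← hlaw.map_eq] at hint
    exact hint.comp_aemeasurable hlaw.aemeasurable
  · have h1 : moment (productVar ξ₁ η₁ ξ₂ η₂ r₁ r₂) n P =
        ∫ ω, productVar ξ₁ η₁ ξ₂ η₂ r₁ r₂ ω ^ n ∂P := rfl
    rw [h1, integral_congr_ae hae, hlaw.integral_comp hint.1, integral_fintype_prod_eq_prod,
      Fin.prod_univ_four]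
    simp only [hf, Matrix.cons_val]
    rw [integral_pow_expMeasure_one, integral_expMeasure_one, integral_expMeasure_one]
    change _ * logMoment n r₁ * _ * logMoment n r₂ = _
    ring

theorem aemeasurable_productVar (hξ₁ : AEMeasurable ξ₁ P) (hη₁ : AEMeasurable η₁ P)
    (hξ₂ : AEMeasurable ξ₂ P) (hη₂ : AEMeasurable η₂ P) :
    AEMeasurable (productVar ξ₁ η₁ ξ₂ η₂ r₁ r₂) P := by
  unfold productVar
  fun_prop

end ProductVar

/-! ### Carleman's condition and failure of quadratic growth -/

/-- A discrete form of (log (2 + log x))' = 1/(x (2 + log x)), giving a telescoping minorant; the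
numerator 2 pays for log (1 + n) in place of log n. -/
theorem log_two_add_log_sub_le {n : ℕ} (hn : 1 ≤ n) :
    Real.log (2 + Real.log ((n + 1 : ℕ) : ℝ)) - Real.log (2 + Real.log (n : ℝ)) ≤
      2 / (n * (2 + Real.log (1 + n))) := by
  have hn1 : (1 : ℝ) ≤ n := by exact_mod_cast hn
  have hn0 : (0 : ℝ) < n := by linarith
  have h0 : 0 ≤ Real.log (n : ℝ) := Real.log_nonneg hn1
  have h1 : Real.log (1 + (n : ℝ)) - Real.log n ≤ 1 / n := by
    rw [← Real.log_div (by positivity) hn0.ne']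
    refine (Real.log_le_sub_one_of_pos (by positivity)).trans (le_of_eq ?_)
    field_simp
    ring
  have h1' : 1 / (n : ℝ) ≤ 1 := by rwa [div_le_one hn0]
  have h2 : 0 ≤ Real.log (1 + (n : ℝ)) := Real.log_nonneg (by linarith)
  push_cast
  rw [add_comm (n : ℝ) 1, ← Real.log_div (by positivity) (by positivity)]
  calc _ ≤ (2 + Real.log (1 + (n : ℝ))) / (2 + Real.log n) - 1 :=
        Real.log_le_sub_one_of_pos (by positivity)
    _ = (Real.log (1 + (n : ℝ)) - Real.log n) / (2 + Real.log n) := by field_simp; ring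
    _ ≤ (1 / n) / (2 + Real.log n) := by gcongr
    _ = 1 / (n * (2 + Real.log n)) := by rw [div_div]
    _ ≤ _ := by
        rw [div_le_div_iff₀ (by positivity) (by positivity)]
        nlinarith

/-- A sequence bounded by `(n log n)` to the power `2 n`, up to constants, satisfies Carleman's
condition. -/
theorem carlemanCondition_of_le {m : ℕ → ℝ} (hpos : ∀ n, 0 < m n)
    (hle : ∀ n, 1 ≤ n → m n ≤ (2 * n * (2 + Real.log (1 + n))) ^ (2 * n)) :
    CarlemanCondition m := by
  have hterm : ∀ n : ℕ, 1 ≤ n → 1 / 4 * (Real.log (2 + Real.log ((n + 1 : ℕ) : ℝ)) -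
      Real.log (2 + Real.log (n : ℝ))) ≤ m n ^ (-(1 / (2 * (n : ℝ)))) := by
    intro n hn
    have hn0 : (0 : ℝ) < n := by exact_mod_cast hn
    have h2 : 0 ≤ Real.log (1 + (n : ℝ)) := Real.log_nonneg (by linarith)
    have hB : 0 < 2 * n * (2 + Real.log (1 + (n : ℝ))) := by positivity
    calc _ ≤ 1 / 4 * (2 / (n * (2 + Real.log (1 + n)))) := by
          gcongr
          exact log_two_add_log_sub_le hn
      _ = (2 * n * (2 + Real.log (1 + n)))⁻¹ := by field_simp; norm_num
      _ = ((2 * n * (2 + Real.log (1 + n))) ^ (2 * n)) ^ (-(1 / (2 * (n : ℝ)))) := by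
          rw [Real.rpow_neg (by positivity), ← Real.rpow_natCast, ← Real.rpow_mul hB.le]
          have : ((2 * n : ℕ) : ℝ) * (1 / (2 * (n : ℝ))) = 1 := by push_cast; field_simp
          rw [this, Real.rpow_one]
      _ ≤ _ := Real.rpow_le_rpow_of_nonpos (hpos n) (hle n hn)
          (neg_nonpos.2 (by positivity))
  have hsum : ∀ N : ℕ, 1 / 4 * (Real.log (2 + Real.log ((N + 1 : ℕ) : ℝ)) -
      Real.log (2 + Real.log ((1 : ℕ) : ℝ))) ≤
      ∑ n ∈ Finset.Icc 1 N, m n ^ (-(1 / (2 * (n : ℝ)))) := by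
    intro N
    have h := Finset.sum_Ico_sub (fun n : ℕ => Real.log (2 + Real.log (n : ℝ)))
      (Nat.le_add_left 1 N)
    rw [← h, Finset.mul_sum, ← Finset.Ico_add_one_right_eq_Icc]
    exact Finset.sum_le_sum fun n hn => hterm n (Finset.mem_Ico.1 hn).1
  refine tendsto_atTop_mono hsum (Tendsto.const_mul_atTop (by norm_num) ?_)
  refine tendsto_atTop_add_const_right _ _ ?_
  exact Real.tendsto_log_atTop.comp (tendsto_atTop_add_const_left _ _
    (Real.tendsto_log_atTop.comp (tendsto_natCast_atTop_atTop.comp (tendsto_add_atTop_nat 1))))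

theorem factorial_sq_mul_logMoment_le {r₁ r₂ : ℝ} (hr₁ : r₁ ∈ Set.Icc (0 : ℝ) 1)
    (hr₂ : r₂ ∈ Set.Icc (0 : ℝ) 1) {n : ℕ} (hn : 1 ≤ n) :
    (n.factorial : ℝ) ^ 2 * logMoment n r₁ * logMoment n r₂ ≤
      (2 * n * (2 + Real.log (1 + n))) ^ (2 * n) := by
  have h2 : 0 ≤ Real.log (1 + (n : ℝ)) := Real.log_nonneg (by simp)
  have hK1 := logMoment_le hr₁ n
  have hK2 := logMoment_le hr₂ n
  have hp1 := logMoment_pos hr₁ n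
  have hp2 := logMoment_pos hr₂ n
  have hf : (n.factorial : ℝ) ≤ (n : ℝ) ^ n := by exact_mod_cast n.factorial_le_pow
  -- For n ≥ 1 the constant 2 in each bound on K_n is absorbed into an n-th power.
  have h2n : (2 : ℝ) ≤ 2 ^ n := by
    simpa using pow_le_pow_right₀ (one_le_two (α := ℝ)) hn
  calc _ ≤ ((n : ℝ) ^ n) ^ 2 * (2 ^ n * (2 + Real.log (1 + n)) ^ n) *
        (2 ^ n * (2 + Real.log (1 + n)) ^ n) := by
        gcongr
        · exact hK1.trans (by gcongr)
        · exact hK2.trans (by gcongr)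
    _ = _ := by
        rw [mul_comm 2 n, pow_mul, mul_pow, mul_pow]
        ring

/-- The factorials contribute exactly (n+1)² to the ratio, so quadratic growth would force q (n+1) ≤
C * q n eventually. -/
theorem not_quadraticGrowth {r₁ r₂ : ℝ} (hr₁ : r₁ ∈ Set.Icc (0 : ℝ) 1)
    (hr₂ : r₂ ∈ Set.Icc (0 : ℝ) 1) (hr : ¬ (r₁ = 0 ∧ r₂ = 0)) :
    ¬ QuadraticGrowth fun n => (n.factorial : ℝ) ^ 2 * logMoment n r₁ * logMoment n r₂ := by
  intro hQ
  obtain ⟨C, hC0, hC⟩ := hQ.exists_pos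
  obtain ⟨N, hN⟩ := eventually_atTop.1 hC.bound
  set q : ℕ → ℝ := fun n => logMoment n r₁ * logMoment n r₂ with hq
  have hq0 : ∀ n, 0 < q n := fun n => mul_pos (logMoment_pos hr₁ n) (logMoment_pos hr₂ n)
  have hs : 0 < r₁ + r₂ := by
    refine lt_of_le_of_ne (add_nonneg hr₁.1 hr₂.1) fun h => hr ⟨?_, ?_⟩ <;>
    linarith [hr₁.1, hr₂.1]
  have hstep : ∀ n, N ≤ n → q (n + 1) ≤ C * q n := by
    intro n hn
    have h := hN n hn
    rw [Real.norm_of_nonneg (by positivity : (0 : ℝ) ≤ ((n : ℝ) + 1) ^ 2)] at h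
    have h' := (le_abs_self _).trans h
    simp only [mul_assoc] at h'
    change (((n + 1).factorial : ℝ) ^ 2 * q (n + 1)) / ((n.factorial : ℝ) ^ 2 * q n) ≤ _ at h'
    have hfac : (0 : ℝ) < n.factorial := by exact_mod_cast n.factorial_pos
    rw [div_le_iff₀ (mul_pos (by positivity) (hq0 n)), Nat.factorial_succ] at h'
    push_cast at h'
    refine le_of_mul_le_mul_left (a := (((n : ℝ) + 1) * n.factorial) ^ 2) ?_ (by positivity)
    calc _ ≤ _ := h'
      _ = _ := by ring
  have hup : ∀ k, q (N + k) ≤ C ^ k * q N := by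
    intro k
    induction k with
    | zero => simp
    | succ k ih =>
      calc q (N + (k + 1)) ≤ C * q (N + k) := hstep (N + k) (by omega)
        _ ≤ C * (C ^ k * q N) := by gcongr
        _ = _ := by ring
  -- T is chosen so that the lower bound for q grows like (2C)^n, beating C^n by 2^n.
  set T := Real.exp ((2 * C) ^ (r₁ + r₂)⁻¹) - 1 with hT
  have hT0 : 0 ≤ T := sub_nonneg.2 (Real.one_le_exp (by positivity))
  have hlogT : Real.log (1 + T) ^ (r₁ + r₂) = 2 * C := by
    rw [hT, add_sub_cancel, Real.log_exp, ← Real.rpow_mul (by positivity),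
      inv_mul_cancel₀ hs.ne', Real.rpow_one]
  have hlow : ∀ n : ℕ, (2 * C) ^ n * Real.exp (-T) ^ 2 ≤ q n := by
    intro n
    have hl0 : 0 < Real.log (1 + T) := by
      rw [hT, add_sub_cancel, Real.log_exp]
      positivity
    calc (2 * C) ^ n * Real.exp (-T) ^ 2
        = (Real.log (1 + T) ^ ((n : ℝ) * r₁) * Real.exp (-T)) *
          (Real.log (1 + T) ^ ((n : ℝ) * r₂) * Real.exp (-T)) := by
          rw [← hlogT, ← Real.rpow_mul_natCast hl0.le, mul_mul_mul_comm,
            ← Real.rpow_add hl0]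
          ring_nf
      _ ≤ _ := mul_le_mul (le_logMoment hr₁ n hT0) (le_logMoment hr₂ n hT0) (by positivity)
          (logMoment_pos hr₁ n).le
  have hpow : ∀ k : ℕ, (2 : ℝ) ^ k ≤ q N / ((2 * C) ^ N * Real.exp (-T) ^ 2) := by
    intro k
    rw [le_div_iff₀ (by positivity)]
    refine le_of_mul_le_mul_left (a := C ^ k) ?_ (by positivity)
    calc _ = (2 * C) ^ (N + k) * Real.exp (-T) ^ 2 := by rw [pow_add, mul_pow 2 C k]; ring
      _ ≤ _ := (hlow _).trans (hup k)
  obtain ⟨k, hk⟩ := pow_unbounded_of_one_lt (q N / ((2 * C) ^ N * Real.exp (-T) ^ 2))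
    (one_lt_two (α := ℝ))
  exact absurd hk (hpow k).not_gt

theorem theorem6 {Ω : Type*} [MeasurableSpace Ω] (P : Measure Ω) [IsProbabilityMeasure P]
    (ξ₁ η₁ ξ₂ η₂ : Ω → ℝ)
    (hξ₁ : HasLaw ξ₁ (expMeasure 1) P) (hη₁ : HasLaw η₁ (expMeasure 1) P)
    (hξ₂ : HasLaw ξ₂ (expMeasure 1) P) (hη₂ : HasLaw η₂ (expMeasure 1) P)
    (hindep : iIndepFun ![ξ₁, η₁, ξ₂, η₂] P)
    (r₁ r₂ : ℝ) (hr₁ : r₁ ∈ Set.Icc (0 : ℝ) 1) (hr₂ : r₂ ∈ Set.Icc (0 : ℝ) 1) :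
    (∀ n : ℕ, Integrable (fun ω => productVar ξ₁ η₁ ξ₂ η₂ r₁ r₂ ω ^ n) P ∧
      moment (productVar ξ₁ η₁ ξ₂ η₂ r₁ r₂) n P =
        (n.factorial : ℝ) ^ 2 * logMoment n r₁ * logMoment n r₂) ∧
    CarlemanCondition (fun n => moment (productVar ξ₁ η₁ ξ₂ η₂ r₁ r₂) n P) ∧
    IsMDeterminate (P.map (productVar ξ₁ η₁ ξ₂ η₂ r₁ r₂)) ∧
    (¬ (r₁ = 0 ∧ r₂ = 0) →
      ¬ QuadraticGrowth (fun n => moment (productVar ξ₁ η₁ ξ₂ η₂ r₁ r₂) n P)) := by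
  have hmom := productVar_moment hξ₁ hη₁ hξ₂ hη₂ hindep hr₁ hr₂
  have hfun : (fun n => moment (productVar ξ₁ η₁ ξ₂ η₂ r₁ r₂) n P) =
      fun n : ℕ => (n.factorial : ℝ) ^ 2 * logMoment n r₁ * logMoment n r₂ :=
    funext fun n => (hmom n).2
  have hpos : ∀ n : ℕ, 0 < (n.factorial : ℝ) ^ 2 * logMoment n r₁ * logMoment n r₂ := fun n =>
    mul_pos (mul_pos (by positivity) (logMoment_pos hr₁ n)) (logMoment_pos hr₂ n)
  have hC : CarlemanCondition
      fun n : ℕ => (n.factorial : ℝ) ^ 2 * logMoment n r₁ * logMoment n r₂ :=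
    carlemanCondition_of_le hpos fun n hn => factorial_sq_mul_logMoment_le hr₁ hr₂ hn
  have hX : AEMeasurable (productVar ξ₁ η₁ ξ₂ η₂ r₁ r₂) P :=
    aemeasurable_productVar hξ₁.aemeasurable hη₁.aemeasurable hξ₂.aemeasurable hη₂.aemeasurable
  have hmap : (fun n : ℕ => ∫ x, x ^ n ∂(P.map (productVar ξ₁ η₁ ξ₂ η₂ r₁ r₂))) =
      fun n : ℕ => (n.factorial : ℝ) ^ 2 * logMoment n r₁ * logMoment n r₂ := by
    funext n
    rw [integral_map hX (by fun_prop), ← (hmom n).2]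
    rfl
  have hlaw : IsStieltjesLaw (P.map (productVar ξ₁ η₁ ξ₂ η₂ r₁ r₂)) := by
    refine ⟨Measure.isProbabilityMeasure_map hX, ?_, fun n => ?_⟩
    · rw [Measure.map_apply_of_aemeasurable hX measurableSet_Iio]
      have h := productVar_ae_nonneg (r₁ := r₁) (r₂ := r₂) hξ₁ hη₁ hξ₂ hη₂
      rw [ae_iff] at h
      simpa [Set.preimage] using h
    · exact (integrable_map_measure (by fun_prop) hX).2 (hmom n).1
  refine ⟨hmom, hfun ▸ hC, hlaw.isMDeterminate_of_carleman (fun n => ?_) (hmap ▸ hC), fun hr => ?_⟩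
  · rw [congrFun hmap n]
    exact hpos n
  · rw [hfun]
    exact not_quadraticGrowth hr₁ hr₂ hr
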